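/- Let $H_A=\mathbb{C}^{d_A}$ and $H_B=\mathbb{C}^{d_B}$ be finite-dimensional Hilbert spaces and $H_{AB}=H_A\otimes H_B$. A property of bipartite pure states is a pair $\mathcal P=(\mathcal P^{\rm yes},\mathcal P^{\rm no})$ of disjoint sets of pure states $|\psi\rangle\langle\psi|$ on $H_{AB}$; it is unitarily invariant on $H_B$ if $(I\otimes U)\rho(I\otimes U)^\dagger\in\mathcal P^{X}$ for every $\rho\in\mathcal P^{X}$, every $X\in\{{\rm yes},{\rm no}\}$ and every unitary $U$ on $H_B$. For $0\le s<c\le 1$, a $(c,s)$-tester for $\mathcal P$ with sample complexity $N$ is an operator $0\sqsubseteq\mathcal T\sqsubseteq I$ (in the Löwner order) on $H_{AB}^{\otimes N}$ such that ${\rm tr}[\mathcal T\rho^{\otimes N}]\ge c$ for all $\rho\in\mathcal P^{\rm yes}$ and ${\rm tr}[\mathcal T\rho^{\otimes N}]\le s$ for all $\rho\in\mathcal P^{\rm no}$. It is local on $H_A$ if $\mathcal T=M_A\otimes I_B$ for some operator $0\sqsubseteq M_A\sqsubseteq I$ on $H_A^{\otimes N}$, where $I_B$ is the identity on $H_B^{\otimes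 N}$. Let $S_{c,s}(\mathcal P)$ be the minimum of the sample complexities of all $(c,s)$-testers for $\mathcal P$ ($\infty$ if there are none). Theorem. Let $\mathcal P$ be a property of bipartite pure states in $H_{AB}$ that is unitarily invariant on $H_B$, and let $0\le s<c\le 1$. (i) For every $N$, if there is a $(c,s)$-tester for $\mathcal P$ with sample complexity $N$, then there is also a $(c,s)$-tester for $\mathcal P$ with the same sample complexity $N$ that is local on $H_A$. (ii) Consequently, if $\mathcal P$ has a $(c,s)$-tester at all, then there is a $(c,s)$-tester for $\mathcal P$ that is local on $H_A$ and whose sample complexity is exactly $S_{c,s}(\mathcal P)$, the optimum over all (global) testers. -/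

import Mathlib

open scoped ComplexOrder

/-! The Hilbert space with standard basis indexed by a finite type `ι` is `ℂ^ι`; linear operators on
it are matrices `Matrix ι ι ℂ`. Its `N`-th tensor power has the standard basis indexed by
`Fin N → ι`, and the bipartite space `H_A ⊗ H_B = ℂ^α ⊗ ℂ^β` has the standard basis indexed by
`α × β`. -/

/-- Density operators (mixed states) on `ℂ^ι`. -/
def IsDensityOperator {ι : Type*} [Fintype ι] (ρ : Matrix ι ι ℂ) : Prop :=
  ρ.PosSemidef ∧ ρ.trace = 1

/-- The pure states `|ψ⟩⟨ψ|`, with `ψ` a unit vector, as density operators. -/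
def IsPureState {ι : Type*} [Fintype ι] (ρ : Matrix ι ι ℂ) : Prop :=
  ∃ ψ : EuclideanSpace ℂ ι, ‖ψ‖ = 1 ∧ ρ = Matrix.vecMulVec (fun i => ψ i) (fun i => star (ψ i))

/-- A property of mixed states: a disjoint pair of sets of density operators. -/
structure StateProperty (ι : Type*) [Fintype ι] where
  yes : Set (Matrix ι ι ℂ)
  no : Set (Matrix ι ι ℂ)
  isDensityOperator_of_mem : ∀ ρ ∈ yes ∪ no, IsDensityOperator ρ
  disjoint : Disjoint yes no

/-- A property of pure states: both sets consist of pure states only. -/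
def StateProperty.IsPure {ι : Type*} [Fintype ι] (P : StateProperty ι) : Prop :=
  ∀ ρ ∈ P.yes ∪ P.no, IsPureState ρ

/-- Conjugation by the local operator `I_A ⊗ U_B`. -/
def conjB {α β : Type*} [Fintype α] [DecidableEq α] [Fintype β] (U : Matrix β β ℂ)
    (ρ : Matrix (α × β) (α × β) ℂ) : Matrix (α × β) (α × β) ℂ :=
  Matrix.kronecker (1 : Matrix α α ℂ) U * ρ *
    (Matrix.kronecker (1 : Matrix α α ℂ) U).conjTranspose

/-- Unitary invariance on `H_B` of a property of bipartite states. -/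
def StateProperty.IsUnitarilyInvariantB {α β : Type*} [Fintype α] [DecidableEq α] [Fintype β]
    [DecidableEq β] (P : StateProperty (α × β)) : Prop :=
  ∀ U ∈ Matrix.unitaryGroup β ℂ,
    (∀ ρ ∈ P.yes, conjB U ρ ∈ P.yes) ∧ (∀ ρ ∈ P.no, conjB U ρ ∈ P.no)

/-- The tensor power `ρ^{⊗N}`. -/
def tensorPow {ι : Type*} (N : ℕ) (ρ : Matrix ι ι ℂ) : Matrix (Fin N → ι) (Fin N → ι) ℂ :=
  Matrix.of fun x y => ∏ i, ρ (x i) (y i)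

/-- The operators `T` with `0 ⊑ T ⊑ I` in the Löwner order. -/
def IsTestOperator {κ : Type*} [DecidableEq κ] (T : Matrix κ κ ℂ) : Prop :=
  T.PosSemidef ∧ (1 - T).PosSemidef

/-- The acceptance probability `tr[T ρ^{⊗N}]`, a real number for the positive semidefinite
operators `T` and `ρ`. -/
noncomputable def acceptProb {ι : Type*} [Fintype ι] {N : ℕ}
    (T : Matrix (Fin N → ι) (Fin N → ι) ℂ) (ρ : Matrix ι ι ℂ) : ℝ :=
  (T * tensorPow N ρ).trace.re

/-- `T` is a `(c, s)`-tester for `P` with sample complexity `N`. -/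
structure IsTester {ι : Type*} [Fintype ι] [DecidableEq ι] (P : StateProperty ι) (c s : ℝ) (N : ℕ)
    (T : Matrix (Fin N → ι) (Fin N → ι) ℂ) : Prop where
  isTestOperator : IsTestOperator T
  completeness : ∀ ρ ∈ P.yes, c ≤ acceptProb T ρ
  soundness : ∀ ρ ∈ P.no, acceptProb T ρ ≤ s

/-- The sample complexity `S_{c,s}(P)`: the least `N` for which there is a `(c, s)`-tester
with sample complexity `N`, and `⊤` if there is no such tester at all. -/
noncomputable def StateProperty.sampleComplexity {ι : Type*} [Fintype ι] [DecidableEq ι]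
    (P : StateProperty ι) (c s : ℝ) : ℕ∞ :=
  ⨅ N ∈ {N : ℕ | ∃ T : Matrix (Fin N → ι) (Fin N → ι) ℂ, IsTester P c s N T}, (N : ℕ∞)

/-- The operator `M ⊗ I` on `H_A^{⊗N} ⊗ H_B^{⊗N}`, seen as an operator on `(H_A ⊗ H_B)^{⊗N}`. -/
def extendA {α β : Type*} [DecidableEq β] {N : ℕ} (M : Matrix (Fin N → α) (Fin N → α) ℂ) :
    Matrix (Fin N → α × β) (Fin N → α × β) ℂ :=
  (Matrix.kronecker M (1 : Matrix (Fin N → β) (Fin N → β) ℂ)).submatrix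
    (fun x => (fun i => (x i).1, fun i => (x i).2)) (fun x => (fun i => (x i).1, fun i => (x i).2))

/-- `T` is local on `H_A`: `T = M_A ⊗ I_B` with `0 ⊑ M_A ⊑ I`. -/
def IsLocalA {α β : Type*} [DecidableEq α] [DecidableEq β] {N : ℕ}
    (T : Matrix (Fin N → α × β) (Fin N → α × β) ℂ) : Prop :=
  ∃ M : Matrix (Fin N → α) (Fin N → α) ℂ, IsTestOperator M ∧ T = extendA M

/-! A pure state on `H_A ⊗ H_B` is a matrix `X : H_B → H_A`, and its `N`-th tensor power is
`X^{⊗N} : H_B^{⊗N} → H_A^{⊗N}`; the span `S` of these matrices is the symmetric subspace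
(`symSpan`). An operator `M ⊗ I` acts on `S` as left multiplication by `M`, and `(I ⊗ U)^{⊗N}` acts
as right multiplication by the transpose of `U^{⊗N}`.

**Symmetrization.** The testers with range in `S` form a closed convex set. It is nonempty as soon
as there is a tester, because a tester may be compressed to `S`, and by the unitary invariance of
the property it is preserved by conjugation with `(I ⊗ U)^{⊗N}`. This conjugation is an isometry for
the Frobenius norm, so the unique tester of least norm commutes with all `(I ⊗ U)^{⊗N}`
(`exists_isTester_commute`). This replaces averaging over Haar measure.

**Unitary trick.** Since an algebra that contains `U^{⊗N}` for every unitary `U` contains `Y^{⊗N}`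
for every matrix `Y` (`tensorPow_mem_of_unitary`), the invariant tester induces a linear map
`Φ : S → S` with `Φ (L Y) = Φ(L) Y` for `Y` in the span of all `Y^{⊗N}`, in particular for
`Y = L₂ᴴ L₃` with `L₂, L₃ ∈ S`.

**Left multiplication.** For a finite set of `E` spanning `S`, let `G = ∑ E Eᴴ` and let `H` be its
pseudo-inverse, so that `G H L = L` on `S`. Then
`(∑ Φ(E) Eᴴ H) L = ∑ Φ(E (Eᴴ H L)) = Φ(G H L) = Φ(L)`, so `Φ` is left multiplication by a matrix.
That matrix may be taken Hermitian, and its spectrum may be clamped to `[0, 1]` without changing the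
action on `S`, since `0 ≤ Φ ≤ 1` there and the functional calculus preserves `S`
(`exists_isTestOperator_mul_eq`). The result `M` satisfies `0 ⊑ M ⊑ I`, and `M ⊗ I` has the same
acceptance probabilities as the invariant tester. -/

open Matrix

/-! ### Module maps as left multiplications by test operators -/

theorem Matrix.continuousOn_real_spectrum {n : Type*} [Fintype n] [DecidableEq n]
    (M : Matrix n n ℂ) (f : ℝ → ℝ) : ContinuousOn f (spectrum ℝ M) := by
  rw [continuousOn_iff_continuous_domRestrict]
  exact continuous_of_discreteTopology

/-- On matrices, every function of the functional calculus agrees with a polynomial on the finite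
spectrum, so it stays in any subalgebra that contains the matrix. -/
theorem Matrix.cfc_mem_subalgebra {n : Type*} [Fintype n] [DecidableEq n]
    (𝒜 : Subalgebra ℂ (Matrix n n ℂ)) {M : Matrix n n ℂ} (hM : M ∈ 𝒜) (hsa : IsSelfAdjoint M)
    (f : ℝ → ℝ) : cfc f M ∈ 𝒜 := by
  classical
  have hfin : (spectrum ℝ M).Finite := M.finite_real_spectrum
  set p : Polynomial ℝ := Lagrange.interpolate hfin.toFinset id f
  have h : cfc f M = cfc p.eval M := by
    refine cfc_congr fun x hx => ?_
    have := Lagrange.eval_interpolate_at_node f (s := hfin.toFinset) (v := id)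
      Function.injective_id.injOn (hfin.mem_toFinset.2 hx)
    exact this.symm
  rw [h, cfc_polynomial p M hsa]
  exact Algebra.adjoin_le (S := 𝒜.restrictScalars ℝ) (Set.singleton_subset_iff.2 hM)
    (Polynomial.aeval_mem_adjoin_singleton ℝ M)

/-- A Hermitian matrix whose compression to the left module `S` lies between `0` and `1` may be
replaced, without changing its action on `S`, by one that lies between `0` and `1` everywhere:
the spectrum is clamped to `[0, 1]`. -/
theorem exists_isTestOperator_mul_eq_of_isSelfAdjoint {W V : Type*} [Fintype W] [DecidableEq W]
    [Fintype V] (S : Submodule ℂ (Matrix W V ℂ)) (𝒜 : Subalgebra ℂ (Matrix W W ℂ))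
    (h𝒜S : ∀ A ∈ 𝒜, ∀ L ∈ S, A * L ∈ S) {M : Matrix W W ℂ} (hM : M ∈ 𝒜) (hsa : IsSelfAdjoint M)
    (hpos : ∀ L ∈ S, 0 ≤ (Lᴴ * (M * L)).trace)
    (hle : ∀ L ∈ S, (Lᴴ * (M * L)).trace ≤ (Lᴴ * L).trace) :
    ∃ M' : Matrix W W ℂ, IsTestOperator M' ∧ ∀ L ∈ S, M' * L = M * L := by
  have hc := M.continuousOn_real_spectrum
  have hstar : ∀ f : ℝ → ℝ, (cfc f M)ᴴ = cfc f M := fun f => IsSelfAdjoint.cfc (f := f) (a := M)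
  have hid : cfc (fun x : ℝ => x) M = M := cfc_id' ℝ M
  have htr : ∀ A : Matrix W V ℂ, 0 ≤ (Aᴴ * A).trace := fun A =>
    (Matrix.posSemidef_conjTranspose_mul_self A).trace_nonneg
  -- the negative part of `M` annihilates `S`: test positivity on `√(M₋) L`
  have h1 : ∀ L ∈ S, cfc (fun x : ℝ => max (-x) 0) M * L = 0 := by
    intro L hL
    set J := cfc (fun x : ℝ => √(-x)) M
    set K := cfc (fun x : ℝ => max (-x) 0) M
    have hJs : Jᴴ = J := hstar _
    have hJ : J * L ∈ S := h𝒜S _ (cfc_mem_subalgebra 𝒜 hM hsa _) L hL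
    have hJMJ : J * (M * J) = -(Kᴴ * K) := by
      conv_lhs => rw [← hid]
      rw [hstar, ← cfc_mul _ _ M (hc _) (hc _), ← cfc_mul _ _ M (hc _) (hc _),
        ← cfc_mul _ _ M (hc _) (hc _), ← cfc_neg]
      refine cfc_congr fun x _ => ?_
      rcases le_total 0 x with hx | hx
      · simp [Real.sqrt_eq_zero_of_nonpos (neg_nonpos.2 hx), hx]
      · have := Real.mul_self_sqrt (neg_nonneg.2 hx)
        simp only [max_eq_left (neg_nonneg.2 hx)]
        linear_combination x * this
    have h := hpos _ hJ
    have e : (J * L)ᴴ * (M * (J * L)) = -((K * L)ᴴ * (K * L)) := by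
      rw [Matrix.conjTranspose_mul, hJs, Matrix.conjTranspose_mul]
      calc Lᴴ * J * (M * (J * L)) = Lᴴ * (J * (M * J)) * L := by simp only [Matrix.mul_assoc]
        _ = _ := by rw [hJMJ]; simp only [Matrix.mul_assoc, Matrix.mul_neg, Matrix.neg_mul]
    rw [e, Matrix.trace_neg] at h
    exact Matrix.trace_conjTranspose_mul_self_eq_zero_iff.1
      (le_antisymm (neg_nonneg.1 h) (htr _))
  -- so does the part of `M` above `1`
  have h2 : ∀ L ∈ S, cfc (fun x : ℝ => max (x - 1) 0) M * L = 0 := by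
    intro L hL
    set J := cfc (fun x : ℝ => √(x - 1)) M
    set K := cfc (fun x : ℝ => max (x - 1) 0) M
    have hJs : Jᴴ = J := hstar _
    have hJ : J * L ∈ S := h𝒜S _ (cfc_mem_subalgebra 𝒜 hM hsa _) L hL
    have hJMJ : J * (M * J) = J * J + Kᴴ * K := by
      conv_lhs => rw [← hid]
      rw [hstar, ← cfc_mul _ _ M (hc _) (hc _), ← cfc_mul _ _ M (hc _) (hc _),
        ← cfc_mul _ _ M (hc _) (hc _), ← cfc_mul _ _ M (hc _) (hc _),
        ← cfc_add _ _ _ (hc _) (hc _)]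
      refine cfc_congr fun x _ => ?_
      rcases le_total x 1 with hx | hx
      · simp [Real.sqrt_eq_zero_of_nonpos (sub_nonpos.2 hx), hx]
      · have := Real.mul_self_sqrt (sub_nonneg.2 hx)
        simp only [max_eq_left (sub_nonneg.2 hx)]
        linear_combination (x - 1) * this
    have h := hle _ hJ
    have e : (J * L)ᴴ * (M * (J * L)) = (J * L)ᴴ * (J * L) + (K * L)ᴴ * (K * L) := by
      rw [Matrix.conjTranspose_mul, hJs, Matrix.conjTranspose_mul]
      calc Lᴴ * J * (M * (J * L)) = Lᴴ * (J * (M * J)) * L := by simp only [Matrix.mul_assoc]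
        _ = _ := by rw [hJMJ]; simp only [Matrix.mul_assoc, Matrix.mul_add, Matrix.add_mul]
    rw [e, Matrix.trace_add, add_le_iff_nonpos_right] at h
    exact Matrix.trace_conjTranspose_mul_self_eq_zero_iff.1 (le_antisymm h (htr _))
  open scoped MatrixOrder in
  have hpsd : ∀ f : ℝ → ℝ, (∀ x, 0 ≤ f x) → (cfc f M).PosSemidef := fun f hf =>
    Matrix.nonneg_iff_posSemidef.1 (cfc_nonneg fun x _ => hf x)
  refine ⟨cfc (fun x : ℝ => max 0 (min x 1)) M, ⟨hpsd _ fun x => le_max_left _ _, ?_⟩, ?_⟩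
  · rw [← cfc_const_one ℝ M, ← cfc_sub _ _ M (hc _) (hc _)]
    exact hpsd _ fun x => sub_nonneg.2 (max_le zero_le_one (min_le_right _ _))
  · intro L hL
    have e : cfc (fun x : ℝ => max 0 (min x 1)) M =
        M + cfc (fun x : ℝ => max (-x) 0) M - cfc (fun x : ℝ => max (x - 1) 0) M := by
      conv_rhs => enter [1, 1]; rw [← hid]
      rw [← cfc_add _ _ _ (hc _) (hc _), ← cfc_sub _ _ M (hc _) (hc _)]
      refine cfc_congr fun x _ => ?_
      grind
    rw [e, Matrix.sub_mul, Matrix.add_mul, h1 L hL, h2 L hL, add_zero, sub_zero]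

/-- The range of the Gram-type operator `∑ E Eᴴ` contains the range of every `L` in the span of
the `E`, and its pseudo-inverse `H` lies in every algebra that contains the `E Eᴴ`. -/
theorem exists_mul_gram_mul_eq {W V : Type*} [Fintype W] [DecidableEq W]
    [Fintype V] (s : Finset (Matrix W V ℂ)) (𝒜 : Subalgebra ℂ (Matrix W W ℂ))
    (h𝒜 : ∀ E ∈ s, E * Eᴴ ∈ 𝒜) :
    ∃ H ∈ 𝒜, ∀ L ∈ Submodule.span ℂ (s : Set (Matrix W V ℂ)), (∑ E ∈ s, E * Eᴴ) * (H * L) = L := by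
  set G : Matrix W W ℂ := ∑ E ∈ s, E * Eᴴ with hG
  have hGsa : Gᴴ = G := by simp [hG, Matrix.conjTranspose_sum]
  have hc := G.continuousOn_real_spectrum
  have hsa : IsSelfAdjoint G := hGsa
  have hid : cfc (fun x : ℝ => x) G = G := cfc_id' ℝ G
  -- the pseudo-inverse of `G`, using `0⁻¹ = 0`
  set H := cfc (fun x : ℝ => x⁻¹) G with hH
  refine ⟨H, cfc_mem_subalgebra 𝒜 (Subalgebra.sum_mem _ h𝒜) hsa _, ?_⟩
  have hGHG : G * H * G = G := by
    have h : cfc (fun x : ℝ => x * x⁻¹ * x) G = cfc (fun x : ℝ => x) G :=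
      cfc_congr fun x _ => mul_inv_mul_cancel x
    rwa [cfc_mul (fun x : ℝ => x * x⁻¹) (fun x => x) G (hc _) (hc _),
      cfc_mul (fun x : ℝ => x) (fun x => x⁻¹) G (hc _) (hc _), hid] at h
  set Q := 1 - G * H with hQ
  have hQG : Q * G = 0 := by rw [hQ, Matrix.sub_mul, hGHG, one_mul, sub_self]
  have hE : ∀ E ∈ s, Q * E = 0 := by
    have h0 : ∑ E ∈ s, ((Q * E) * (Q * E)ᴴ).trace = 0 := by
      rw [← Matrix.trace_sum]
      have : ∑ E ∈ s, ((Q * E) * (Q * E)ᴴ) = Q * G * Qᴴ := by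
        rw [hG, Matrix.mul_sum, Matrix.sum_mul]
        simp only [Matrix.conjTranspose_mul, Matrix.mul_assoc]
      rw [this, hQG, Matrix.zero_mul, Matrix.trace_zero]
    intro E hEs
    exact Matrix.trace_mul_conjTranspose_self_eq_zero_iff.1 ((Finset.sum_eq_zero_iff_of_nonneg
      (fun A _ => (Matrix.posSemidef_self_mul_conjTranspose (Q * A)).trace_nonneg)).1 h0 E hEs)
  intro L hL
  have hQL : Q * L = 0 := by
    induction hL using Submodule.span_induction with
    | mem E h => exact hE E h
    | zero => simp
    | add x y _ _ hx hy => rw [Matrix.mul_add, hx, hy, add_zero]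
    | smul a x _ hx => rw [Matrix.mul_smul, hx, smul_zero]
  rw [hQ, Matrix.sub_mul, Matrix.one_mul, sub_eq_zero, Matrix.mul_assoc] at hQL
  exact hQL.symm

/-- Let `S` be a space of rectangular matrices closed under `(L₁, L₂, L₃) ↦ L₁ L₂ᴴ L₃`. A map
`Φ : S → S` between `0` and `1` for the Hilbert–Schmidt inner product that commutes with right
multiplication by `Lᴴ L'` is left multiplication by a test operator. -/
theorem exists_isTestOperator_mul_eq {W V : Type*} [Fintype W] [DecidableEq W] [Fintype V]
    (S : Submodule ℂ (Matrix W V ℂ))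
    (hS : ∀ L₁ ∈ S, ∀ L₂ ∈ S, ∀ L₃ ∈ S, L₁ * (L₂ᴴ * L₃) ∈ S)
    (Φ : Matrix W V ℂ →ₗ[ℂ] Matrix W V ℂ) (hΦS : ∀ L ∈ S, Φ L ∈ S)
    (hΦmul : ∀ L₁ ∈ S, ∀ L₂ ∈ S, ∀ L₃ ∈ S, Φ (L₁ * (L₂ᴴ * L₃)) = Φ L₁ * (L₂ᴴ * L₃))
    (hsymm : ∀ L₁ ∈ S, ∀ L₂ ∈ S, ((Φ L₁)ᴴ * L₂).trace = (L₁ᴴ * Φ L₂).trace)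
    (hpos : ∀ L ∈ S, 0 ≤ (Lᴴ * Φ L).trace)
    (hle : ∀ L ∈ S, (Lᴴ * Φ L).trace ≤ (Lᴴ * L).trace) :
    ∃ M : Matrix W W ℂ, IsTestOperator M ∧ ∀ L ∈ S, M * L = Φ L := by
  -- the matrices `A` such that both `A` and `Aᴴ` preserve `S`
  let 𝒜 : Subalgebra ℂ (Matrix W W ℂ) :=
    { carrier := {A | ∀ L ∈ S, A * L ∈ S ∧ Aᴴ * L ∈ S}
      mul_mem' := fun {A B} hA hB L hL => by
        rw [Matrix.conjTranspose_mul, Matrix.mul_assoc, Matrix.mul_assoc]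
        exact ⟨(hA _ (hB L hL).1).1, (hB _ (hA L hL).2).2⟩
      add_mem' := fun {A B} hA hB L hL => by
        rw [Matrix.conjTranspose_add, Matrix.add_mul, Matrix.add_mul]
        exact ⟨S.add_mem (hA L hL).1 (hB L hL).1, S.add_mem (hA L hL).2 (hB L hL).2⟩
      algebraMap_mem' := fun r L hL => by
        rw [Algebra.algebraMap_eq_smul_one, Matrix.conjTranspose_smul, Matrix.conjTranspose_one,
          Matrix.smul_mul, Matrix.smul_mul, Matrix.one_mul]
        exact ⟨S.smul_mem _ hL, S.smul_mem _ hL⟩ }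
  have h𝒜star : ∀ A ∈ 𝒜, Aᴴ ∈ 𝒜 := fun A hA L hL => by
    rw [Matrix.conjTranspose_conjTranspose]; exact (hA L hL).symm
  have hmul𝒜 : ∀ L₁ ∈ S, ∀ L₂ ∈ S, L₁ * L₂ᴴ ∈ 𝒜 := fun L₁ h₁ L₂ h₂ L hL => by
    rw [Matrix.conjTranspose_mul, Matrix.conjTranspose_conjTranspose, Matrix.mul_assoc,
      Matrix.mul_assoc]
    exact ⟨hS _ h₁ _ h₂ _ hL, hS _ h₂ _ h₁ _ hL⟩
  obtain ⟨s, hs⟩ : S.FG := IsNoetherian.noetherian S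
  have hsS : ∀ E ∈ s, E ∈ S := fun E hE => hs ▸ Submodule.subset_span hE
  obtain ⟨H, hH𝒜, hH⟩ := exists_mul_gram_mul_eq s 𝒜
    (fun E hE => hmul𝒜 _ (hsS E hE) _ (hsS E hE))
  rw [hs] at hH
  set M₀ : Matrix W W ℂ := ∑ E ∈ s, Φ E * Eᴴ * H with hM₀
  have hM₀𝒜 : M₀ ∈ 𝒜 := Subalgebra.sum_mem _ fun E hE =>
    𝒜.mul_mem (hmul𝒜 _ (hΦS _ (hsS E hE)) _ (hsS E hE)) hH𝒜
  have hM₀L : ∀ L ∈ S, M₀ * L = Φ L := by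
    intro L hL
    have hHL : H * L ∈ S := (hH𝒜 L hL).1
    calc M₀ * L = ∑ E ∈ s, Φ E * (Eᴴ * (H * L)) := by
          rw [hM₀, Matrix.sum_mul]; simp only [Matrix.mul_assoc]
      _ = ∑ E ∈ s, Φ (E * (Eᴴ * (H * L))) := Finset.sum_congr rfl fun E hE =>
          (hΦmul _ (hsS E hE) _ (hsS E hE) _ hHL).symm
      _ = Φ ((∑ E ∈ s, E * Eᴴ) * (H * L)) := by
          rw [← map_sum, Matrix.sum_mul]; simp only [Matrix.mul_assoc]
      _ = Φ L := by rw [hH L hL]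
  have hM₀star : ∀ L ∈ S, M₀ᴴ * L = Φ L := by
    intro L hL
    have hD : M₀ᴴ * L - Φ L ∈ S := S.sub_mem (hM₀𝒜 L hL).2 (hΦS L hL)
    have h : ∀ L' ∈ S, (L'ᴴ * (M₀ᴴ * L - Φ L)).trace = 0 := by
      intro L' hL'
      rw [Matrix.mul_sub, Matrix.trace_sub, ← hsymm L' hL' L hL, ← hM₀L L' hL',
        Matrix.conjTranspose_mul, Matrix.mul_assoc, sub_self]
    exact sub_eq_zero.1 (Matrix.trace_conjTranspose_mul_self_eq_zero_iff.1 (h _ hD))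
  set M : Matrix W W ℂ := (2⁻¹ : ℂ) • (M₀ + M₀ᴴ) with hM
  have hM𝒜 : M ∈ 𝒜 := 𝒜.smul_mem (𝒜.add_mem hM₀𝒜 (h𝒜star _ hM₀𝒜)) _
  have hMsa : IsSelfAdjoint M := by
    rw [isSelfAdjoint_iff, Matrix.star_eq_conjTranspose, hM, Matrix.conjTranspose_smul,
      Matrix.conjTranspose_add, Matrix.conjTranspose_conjTranspose, add_comm]
    simp
  have hML : ∀ L ∈ S, M * L = Φ L := fun L hL => by
    rw [hM, Matrix.smul_mul, Matrix.add_mul, hM₀L L hL, hM₀star L hL, ← two_smul ℂ, smul_smul]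
    norm_num
  obtain ⟨M', hM', h⟩ := exists_isTestOperator_mul_eq_of_isSelfAdjoint S 𝒜
    (fun A hA L hL => (hA L hL).1) hM𝒜 hMsa (fun L hL => by rw [hML L hL]; exact hpos L hL)
    (fun L hL => by rw [hML L hL]; exact hle L hL)
  exact ⟨M', hM', fun L hL => (h L hL).trans (hML L hL)⟩

/-! ### Tensor powers and the unitary trick -/

/-- The tensor power `X^{⊗N}` of a rectangular matrix `X`; for square matrices it is `tensorPow` by
definition. -/
def tensorPowRect {α β : Type*} (N : ℕ) (X : Matrix α β ℂ) : Matrix (Fin N → α) (Fin N → β) ℂ :=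
  Matrix.of fun x y => ∏ i, X (x i) (y i)

section TensorPow

variable {α β γ : Type*} {N : ℕ}

theorem tensorPowRect_mul [Fintype β] (X : Matrix α β ℂ) (Y : Matrix β γ ℂ) :
    tensorPowRect N (X * Y) = tensorPowRect N X * tensorPowRect N Y := by
  classical
  ext x y
  simp only [tensorPowRect, Matrix.of_apply, Matrix.mul_apply, Finset.prod_univ_sum,
    Fintype.piFinset_univ, Finset.prod_mul_distrib]

theorem tensorPowRect_conjTranspose (X : Matrix α β ℂ) :
    tensorPowRect N Xᴴ = (tensorPowRect N X)ᴴ := by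
  ext x y
  simp [tensorPowRect, Matrix.conjTranspose_apply]

theorem tensorPow_mul [Fintype α] (X Y : Matrix α α ℂ) :
    tensorPow N (X * Y) = tensorPow N X * tensorPow N Y := tensorPowRect_mul X Y

theorem tensorPow_conjTranspose (X : Matrix α α ℂ) :
    tensorPow N Xᴴ = (tensorPow N X)ᴴ := tensorPowRect_conjTranspose X

theorem tensorPow_one [DecidableEq α] : tensorPow N (1 : Matrix α α ℂ) = 1 := by
  ext x y
  simp only [tensorPow, Matrix.of_apply, Matrix.one_apply, Finset.prod_ite_zero,
    Finset.mem_univ, true_imp_iff, Finset.prod_const_one, funext_iff]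

end TensorPow

section UnitarySpan

variable {β : Type*} [Fintype β] {N : ℕ}

/-- A linear functional applied to `(A + z B)^{⊗N}` is a polynomial in `z`, so a subspace that
contains these powers for infinitely many `z` contains them for all `z`. -/
theorem tensorPow_add_smul_mem (K : Submodule ℂ (Matrix (Fin N → β) (Fin N → β) ℂ))
    (A B : Matrix β β ℂ) {Z : Set ℂ} (hZ : Z.Infinite)
    (h : ∀ z ∈ Z, tensorPow N (A + z • B) ∈ K) (z : ℂ) : tensorPow N (A + z • B) ∈ K := by
  classical
  by_contra hz
  obtain ⟨f, hfz, hf⟩ := Submodule.exists_le_ker_of_notMem hz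
  let p : Polynomial ℂ := ∑ x, ∑ y, Polynomial.C (f (Matrix.single x y 1)) *
    ∏ i, (Polynomial.C (A (x i) (y i)) + Polynomial.X * Polynomial.C (B (x i) (y i)))
  have hp : ∀ w, p.eval w = f (tensorPow N (A + w • B)) := by
    intro w
    conv_rhs => rw [Matrix.matrix_eq_sum_single (tensorPow N (A + w • B))]
    simp only [p, Polynomial.eval_finsetSum, Polynomial.eval_mul, Polynomial.eval_C,
      Polynomial.eval_prod, Polynomial.eval_add, Polynomial.eval_X, map_sum]
    refine Finset.sum_congr rfl fun x _ => Finset.sum_congr rfl fun y _ => ?_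
    rw [show Matrix.single x y (tensorPow N (A + w • B) x y) =
      tensorPow N (A + w • B) x y • Matrix.single x y (1 : ℂ) by simp, map_smul, smul_eq_mul,
      mul_comm]
    rfl
  have hp0 : p = 0 := by
    refine p.eq_zero_of_infinite_isRoot (hZ.mono fun w hw => ?_)
    rw [Set.mem_ofPred_eq, Polynomial.IsRoot, hp]
    exact hf (h w hw)
  exact hfz (by rw [← hp, hp0, Polynomial.eval_zero])

variable [DecidableEq β]

/-- The tensor powers of a diagonal matrix lie in every subspace that contains the tensor powers
of the unitaries: release the moduli of the diagonal entries one at a time. -/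
theorem tensorPow_diagonal_mem (K : Submodule ℂ (Matrix (Fin N → β) (Fin N → β) ℂ))
    (hK : ∀ U ∈ Matrix.unitaryGroup β ℂ, tensorPow N U ∈ K) (d : β → ℂ) :
    tensorPow N (Matrix.diagonal d) ∈ K := by
  suffices ∀ (s : Finset β) (d : β → ℂ), (∀ i ∉ s, ‖d i‖ = 1) →
      tensorPow N (Matrix.diagonal d) ∈ K from
    this Finset.univ d fun i hi => absurd (Finset.mem_univ i) hi
  intro s
  induction s using Finset.induction with
  | empty =>
    intro d hd
    refine hK _ ?_
    rw [Matrix.mem_unitaryGroup_iff, Matrix.star_eq_conjTranspose, Matrix.diagonal_conjTranspose,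
      Matrix.diagonal_mul_diagonal, ← Matrix.diagonal_one]
    congr 1
    ext i
    simp [Complex.mul_conj, Complex.normSq_eq_norm_sq, hd i]
  | insert a s _ ih =>
    intro d hd
    have hdiag : ∀ z : ℂ, Matrix.diagonal (Function.update d a 0) +
        z • Matrix.diagonal (Pi.single a 1) = Matrix.diagonal (Function.update d a z) := by
      intro z
      rw [← Matrix.diagonal_smul, Matrix.diagonal_add]
      congr 1
      ext i
      by_cases hi : i = a
      · subst hi; simp
      · simp [hi]
    have hinf : (Metric.sphere (0 : ℂ) 1).Infinite :=
      (isPreconnected_sphere (by rw [Complex.rank_real_complex]; exact Nat.one_lt_ofNat)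
        0 1).infinite_of_nontrivial ⟨1, by simp, -1, by simp, by norm_num⟩
    have := tensorPow_add_smul_mem K _ (Matrix.diagonal (Pi.single a 1)) hinf (fun z hz => by
      rw [hdiag]
      refine ih _ fun i hi => ?_
      by_cases hia : i = a
      · subst hia; simpa using hz
      · rw [Function.update_of_ne hia]
        exact hd i (by simp [hia, hi])) (d a)
    rwa [hdiag, Function.update_eq_self] at this

/-- A subalgebra that contains the tensor powers of all unitaries contains the tensor powers of
all matrices (unitary trick): pass to Hermitian matrices by the spectral theorem, and then to
`A + i B` with `A` and `B` Hermitian. -/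
theorem tensorPow_mem_of_unitary (K : Subalgebra ℂ (Matrix (Fin N → β) (Fin N → β) ℂ))
    (hK : ∀ U ∈ Matrix.unitaryGroup β ℂ, tensorPow N U ∈ K) (Y : Matrix β β ℂ) :
    tensorPow N Y ∈ K := by
  have hherm : ∀ A : Matrix β β ℂ, A.IsHermitian → tensorPow N A ∈ K := by
    intro A hA
    rw [hA.spectral_theorem, Unitary.conjStarAlgAut_apply, tensorPow_mul, tensorPow_mul]
    exact K.mul_mem (K.mul_mem (hK _ hA.eigenvectorUnitary.2)
      (tensorPow_diagonal_mem K.toSubmodule hK _))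
      (hK _ (star hA.eigenvectorUnitary).2)
  rw [← realPart_add_I_smul_imaginaryPart Y]
  refine tensorPow_add_smul_mem K.toSubmodule _ _
    (Set.infinite_range_of_injective Complex.ofReal_injective) ?_ Complex.I
  rintro _ ⟨t, rfl⟩
  refine hherm _ (IsSelfAdjoint.add (realPart Y).2 ?_)
  exact IsSelfAdjoint.smul (Complex.conj_ofReal t) (imaginaryPart Y).2

end UnitarySpan

/-! ### Matrices of least Frobenius norm and test operators -/

section MinimalNorm

variable {κ : Type*}

theorem convex_setOf_isTestOperator [DecidableEq κ] :
    Convex ℝ {T : Matrix κ κ ℂ | IsTestOperator T} := by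
  intro T hT T' hT' a b ha hb hab
  refine ⟨(hT.1.smul ha).add (hT'.1.smul hb), ?_⟩
  have : 1 - (a • T + b • T') = a • (1 - T) + b • (1 - T') := by
    rw [smul_sub, smul_sub, sub_add_sub_comm, ← add_smul, hab, one_smul]
  rw [this]
  exact (hT.2.smul ha).add (hT'.2.smul hb)

variable [Fintype κ]

theorem Matrix.re_trace_conjTranspose_mul_self (T : Matrix κ κ ℂ) :
    (Tᴴ * T).trace.re = ‖(WithLp.toLp 2 fun p : κ × κ => T p.1 p.2 : EuclideanSpace ℂ (κ × κ))‖ ^ 2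
    := by
  rw [EuclideanSpace.norm_sq_eq, Fintype.sum_prod_type, Finset.sum_comm]
  simp only [Matrix.trace, Matrix.diag, Matrix.mul_apply, Matrix.conjTranspose_apply, Complex.re_sum]
  refine Finset.sum_congr rfl fun x _ => Finset.sum_congr rfl fun y _ => ?_
  rw [RCLike.star_def, Complex.conj_mul', ← Complex.ofReal_pow, Complex.ofReal_re]

/-- A nonempty closed convex set of matrices has a unique element of least Frobenius norm; in
particular that element is fixed by every Frobenius isometry preserving the set. -/
theorem exists_unique_minimal_frobenius {C : Set (Matrix κ κ ℂ)} (hne : C.Nonempty)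
    (hclosed : IsClosed C) (hconv : Convex ℝ C) :
    ∃ T ∈ C, ∀ T' ∈ C, (T'ᴴ * T').trace.re ≤ (Tᴴ * T).trace.re → T' = T := by
  let E := EuclideanSpace ℂ (κ × κ)
  let f : E →ₗ[ℝ] Matrix κ κ ℂ :=
    { toFun := fun v => Matrix.of fun x y => v (x, y)
      map_add' := fun _ _ => rfl
      map_smul' := fun _ _ => rfl }
  let g : Matrix κ κ ℂ → E := fun T => WithLp.toLp 2 fun p => T p.1 p.2
  have hfg : ∀ T, f (g T) = T := fun _ => rfl
  have hgf : ∀ v, g (f v) = v := fun _ => rfl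
  have hf : Continuous f := by
    refine continuous_matrix fun x y => ?_
    exact EuclideanSpace.proj (𝕜 := ℂ) (x, y) |>.continuous
  have hKc : Convex ℝ (f ⁻¹' C) := hconv.linear_preimage f
  obtain ⟨v, hv, hmin⟩ := exists_norm_eq_iInf_of_complete_convex (K := f ⁻¹' C)
    (by obtain ⟨T, hT⟩ := hne; exact ⟨g T, hT⟩) (hclosed.preimage hf).isComplete hKc (0 : E)
  rw [norm_eq_iInf_iff_real_inner_le_zero hKc hv] at hmin
  refine ⟨f v, hv, fun T' hT' hle => ?_⟩
  rw [Matrix.re_trace_conjTranspose_mul_self, Matrix.re_trace_conjTranspose_mul_self] at hle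
  change ‖g T'‖ ^ 2 ≤ ‖v‖ ^ 2 at hle
  have h := hmin (g T') hT'
  have h0 : ‖g T' - v‖ ^ 2 ≤ 0 := by
    have e : (0 : E) - v = -v := zero_sub v
    rw [e, inner_neg_left, inner_sub_right, real_inner_self_eq_norm_sq] at h
    rw [norm_sub_sq_real, real_inner_comm]
    linarith
  have h1 : g T' = v := by
    rw [← sub_eq_zero, ← norm_eq_zero]
    exact pow_eq_zero_iff two_ne_zero |>.1 (le_antisymm h0 (sq_nonneg _))
  rw [← h1, hfg]

theorem Matrix.isClosed_setOf_posSemidef : IsClosed {T : Matrix κ κ ℂ | T.PosSemidef} := by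
  simp only [Matrix.posSemidef_iff_dotProduct_mulVec, Matrix.IsHermitian, Set.ofPred_and,
    Set.ofPred_forall]
  refine (isClosed_eq (by fun_prop) continuous_id).inter (isClosed_iInter fun x => ?_)
  exact isClosed_le continuous_const (by fun_prop)

theorem isClosed_setOf_isTestOperator [DecidableEq κ] :
    IsClosed {T : Matrix κ κ ℂ | IsTestOperator T} :=
  Matrix.isClosed_setOf_posSemidef.inter
    (Matrix.isClosed_setOf_posSemidef.preimage (continuous_const.sub continuous_id))

theorem IsTestOperator.conjTranspose_mul_mul_same [DecidableEq κ] {T Q : Matrix κ κ ℂ}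
    (hT : IsTestOperator T) (hQ : (1 - Qᴴ * Q).PosSemidef) : IsTestOperator (Qᴴ * T * Q) := by
  refine ⟨hT.1.conjTranspose_mul_mul_same Q, ?_⟩
  have : 1 - Qᴴ * T * Q = (1 - Qᴴ * Q) + Qᴴ * (1 - T) * Q := by
    rw [Matrix.mul_sub, Matrix.sub_mul, Matrix.mul_one]; abel
  rw [this]
  exact hQ.add (hT.2.conjTranspose_mul_mul_same Q)

/-- Compressing `T` to a subspace: the witness is `Π T Π`, with `Π` the orthogonal projection. -/
theorem exists_isTestOperator_compression [DecidableEq κ] (S : Submodule ℂ (κ → ℂ)) {T : Matrix κ κ ℂ} (hT : IsTestOperator T) :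
    ∃ T', IsTestOperator T' ∧ (∀ v, T' *ᵥ v ∈ S) ∧
      ∀ v ∈ S, star v ⬝ᵥ T' *ᵥ v = star v ⬝ᵥ T *ᵥ v := by
  let S' : Submodule ℂ (EuclideanSpace ℂ κ) :=
    S.comap (WithLp.linearEquiv 2 ℂ (κ → ℂ)).toLinearMap
  let Q : Matrix κ κ ℂ := (Matrix.toEuclideanCLM (n := κ) (𝕜 := ℂ)).symm S'.starProjection
  have hproj : IsStarProjection S'.starProjection := isStarProjection_starProjection
  have hQQ : Q * Q = Q := by
    rw [← map_mul, hproj.isIdempotentElem.eq]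
  have hQs : Qᴴ = Q := by
    have h := (Matrix.toEuclideanCLM (n := κ) (𝕜 := ℂ)).symm.map_star' S'.starProjection
    rw [hproj.isSelfAdjoint.star_eq] at h
    exact h.symm
  have hQv : ∀ v : κ → ℂ, Q *ᵥ v = (S'.starProjection (WithLp.toLp 2 v)).ofLp := by
    intro v
    rw [← (Matrix.toEuclideanCLM (n := κ) (𝕜 := ℂ)).apply_symm_apply S'.starProjection]
    rfl
  have hQmem : ∀ v, Q *ᵥ v ∈ S := fun v => by
    rw [hQv]
    exact Submodule.starProjection_apply_mem S' _
  have hQfix : ∀ v ∈ S, Q *ᵥ v = v := fun v hv => by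
    rw [hQv, Submodule.starProjection_eq_self_iff.2 (show WithLp.toLp 2 v ∈ S' from hv)]
  refine ⟨Qᴴ * T * Q, hT.conjTranspose_mul_mul_same ?_, fun v => ?_, fun v hv => ?_⟩
  · have : 1 - Qᴴ * Q = (1 - Q)ᴴ * (1 - Q) := by
      rw [Matrix.conjTranspose_sub, Matrix.conjTranspose_one, hQs, Matrix.mul_sub, Matrix.sub_mul,
        Matrix.sub_mul, hQQ]
      simp
    rw [this]
    exact Matrix.posSemidef_conjTranspose_mul_self _
  · rw [hQs, Matrix.mul_assoc, ← Matrix.mulVec_mulVec]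
    exact hQmem _
  · rw [← Matrix.mulVec_mulVec, ← Matrix.mulVec_mulVec, hQfix v hv, Matrix.dotProduct_mulVec,
      ← Matrix.star_mulVec, hQfix v hv]

end MinimalNorm

/-! ### Acceptance probabilities and the convex set of testers -/

section Testers

variable {ι : Type*} [Fintype ι] {N : ℕ}

theorem acceptProb_add_smul (a b : ℝ) (T T' : Matrix (Fin N → ι) (Fin N → ι) ℂ)
    (ρ : Matrix ι ι ℂ) :
    acceptProb (a • T + b • T') ρ = a * acceptProb T ρ + b * acceptProb T' ρ := by
  simp [acceptProb, Matrix.add_mul, Matrix.trace_add, Matrix.trace_smul]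

theorem continuous_acceptProb (ρ : Matrix ι ι ℂ) :
    Continuous fun T : Matrix (Fin N → ι) (Fin N → ι) ℂ => acceptProb T ρ := by
  unfold acceptProb
  fun_prop

theorem acceptProb_vecMulVec (T : Matrix (Fin N → ι) (Fin N → ι) ℂ) (ψ : ι → ℂ) :
    acceptProb T (Matrix.vecMulVec ψ (fun i => star (ψ i))) =
      (star (fun x : Fin N → ι => ∏ i, ψ (x i)) ⬝ᵥ T *ᵥ fun x => ∏ i, ψ (x i)).re := by
  have : tensorPow N (Matrix.vecMulVec ψ (fun i => star (ψ i))) =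
      Matrix.vecMulVec (fun x => ∏ i, ψ (x i)) (star fun x => ∏ i, ψ (x i)) := by
    ext x y
    simp [tensorPow, Matrix.vecMulVec_apply, Finset.prod_mul_distrib]
  rw [acceptProb, this, Matrix.mul_vecMulVec, Matrix.trace_vecMulVec, dotProduct_comm]

variable [DecidableEq ι]

theorem isTester_iff (P : StateProperty ι) (c s : ℝ) (T : Matrix (Fin N → ι) (Fin N → ι) ℂ) :
    IsTester P c s N T ↔ IsTestOperator T ∧ (∀ ρ ∈ P.yes, c ≤ acceptProb T ρ) ∧
      ∀ ρ ∈ P.no, acceptProb T ρ ≤ s :=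
  ⟨fun h => ⟨h.1, h.2, h.3⟩, fun h => ⟨h.1, h.2.1, h.2.2⟩⟩

theorem isClosed_setOf_isTester (P : StateProperty ι) (c s : ℝ) :
    IsClosed {T : Matrix (Fin N → ι) (Fin N → ι) ℂ | IsTester P c s N T} := by
  simp only [isTester_iff, Set.ofPred_and, Set.ofPred_forall]
  refine isClosed_setOf_isTestOperator.inter (IsClosed.inter ?_ ?_)
  · exact isClosed_biInter fun ρ _ => isClosed_le continuous_const (continuous_acceptProb ρ)
  · exact isClosed_biInter fun ρ _ => isClosed_le (continuous_acceptProb ρ) continuous_const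

theorem convex_setOf_isTester (P : StateProperty ι) (c s : ℝ) :
    Convex ℝ {T : Matrix (Fin N → ι) (Fin N → ι) ℂ | IsTester P c s N T} := by
  intro T hT T' hT' a b ha hb hab
  refine ⟨convex_setOf_isTestOperator hT.1 hT'.1 ha hb hab, fun ρ hρ => ?_, fun ρ hρ => ?_⟩
  · rw [acceptProb_add_smul]
    calc c = a * c + b * c := by rw [← add_mul, hab, one_mul]
      _ ≤ _ := by gcongr; exacts [hT.2 ρ hρ, hT'.2 ρ hρ]
  · rw [acceptProb_add_smul]
    calc _ ≤ a * s + b * s := by gcongr; exacts [hT.3 ρ hρ, hT'.3 ρ hρ]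
      _ = s := by rw [← add_mul, hab, one_mul]

/-- Testers depend only on the acceptance probabilities of the states of the property. -/
theorem IsTester.of_acceptProb_eq {P : StateProperty ι} {c s : ℝ}
    {T T' : Matrix (Fin N → ι) (Fin N → ι) ℂ} (hT : IsTester P c s N T) (hT' : IsTestOperator T')
    (h : ∀ ρ ∈ P.yes ∪ P.no, acceptProb T' ρ = acceptProb T ρ) : IsTester P c s N T' :=
  ⟨hT', fun ρ hρ => (h ρ (.inl hρ)).symm ▸ hT.2 ρ hρ, fun ρ hρ => (h ρ (.inr hρ)).symm ▸ hT.3 ρ hρ⟩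

end Testers

/-! ### Bipartite tensor powers -/

section Bipartite

variable {α β : Type*} {N : ℕ}

/-- The identification of operators `H_B^{⊗N} → H_A^{⊗N}` with vectors of `(H_A ⊗ H_B)^{⊗N}`. -/
def vecTensor (α β : Type*) (N : ℕ) :
    Matrix (Fin N → α) (Fin N → β) ℂ ≃ₗ[ℂ] ((Fin N → α × β) → ℂ) where
  toFun L x := L (fun i => (x i).1) (fun i => (x i).2)
  invFun v := Matrix.of fun a b => v fun i => (a i, b i)
  map_add' _ _ := rfl
  map_smul' _ _ := rfl
  left_inv _ := rfl
  right_inv _ := rfl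

theorem vecTensor_apply (L : Matrix (Fin N → α) (Fin N → β) ℂ) (x : Fin N → α × β) :
    vecTensor α β N L x = L (fun i => (x i).1) (fun i => (x i).2) := rfl

theorem prod_eq_vecTensor (ψ : α × β → ℂ) :
    (fun x : Fin N → α × β => ∏ i, ψ (x i)) =
      vecTensor α β N (tensorPowRect N (Matrix.of fun a b => ψ (a, b))) := rfl

/-- The operators `H_B^{⊗N} → H_A^{⊗N}` that correspond to vectors in the symmetric subspace of
`(H_A ⊗ H_B)^{⊗N}`: the span of the tensor powers. -/
def symSpan (α β : Type*) (N : ℕ) : Submodule ℂ (Matrix (Fin N → α) (Fin N → β) ℂ) :=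
  Submodule.span ℂ (Set.range (tensorPowRect N))

theorem tensorPowRect_mem_symSpan (X : Matrix α β ℂ) : tensorPowRect N X ∈ symSpan α β N :=
  Submodule.subset_span ⟨X, rfl⟩

theorem mul_mem_symSpan [Fintype β] {γ : Type*} {L : Matrix (Fin N → α) (Fin N → β) ℂ}
    (hL : L ∈ symSpan α β N) {L' : Matrix (Fin N → β) (Fin N → γ) ℂ} (hL' : L' ∈ symSpan β γ N) :
    L * L' ∈ symSpan α γ N := by
  induction hL using Submodule.span_induction with
  | mem _ h =>
    obtain ⟨X, rfl⟩ := h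
    induction hL' using Submodule.span_induction with
    | mem _ h =>
      obtain ⟨Y, rfl⟩ := h
      rw [← tensorPowRect_mul]
      exact tensorPowRect_mem_symSpan _
    | zero => rw [Matrix.mul_zero]; exact zero_mem _
    | add _ _ _ _ h h' => rw [Matrix.mul_add]; exact add_mem h h'
    | smul a _ _ h => rw [Matrix.mul_smul]; exact Submodule.smul_mem _ _ h
  | zero => rw [Matrix.zero_mul]; exact zero_mem _
  | add _ _ _ _ h h' => rw [Matrix.add_mul]; exact add_mem h h'
  | smul a _ _ h => rw [Matrix.smul_mul]; exact Submodule.smul_mem _ _ h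

theorem conjTranspose_mem_symSpan {L : Matrix (Fin N → α) (Fin N → β) ℂ}
    (hL : L ∈ symSpan α β N) : Lᴴ ∈ symSpan β α N := by
  induction hL using Submodule.span_induction with
  | mem _ h =>
    obtain ⟨X, rfl⟩ := h
    rw [← tensorPowRect_conjTranspose]
    exact tensorPowRect_mem_symSpan _
  | zero => rw [Matrix.conjTranspose_zero]; exact zero_mem _
  | add _ _ _ _ h h' => rw [Matrix.conjTranspose_add]; exact add_mem h h'
  | smul a _ _ h => rw [Matrix.conjTranspose_smul]; exact Submodule.smul_mem _ _ h

variable [Fintype α] [Fintype β]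

theorem sum_tensor_eq (f : (Fin N → α × β) → ℂ) :
    ∑ x, f x = ∑ a : Fin N → α, ∑ b : Fin N → β, f fun i => (a i, b i) := by
  rw [← Fintype.sum_prod_type']
  exact Fintype.sum_equiv (Equiv.arrowProdEquivProdArrow (Fin N) (fun _ => α) (fun _ => β)) _ _
    fun _ => rfl

theorem star_vecTensor_dotProduct (L L' : Matrix (Fin N → α) (Fin N → β) ℂ) :
    star (vecTensor α β N L) ⬝ᵥ vecTensor α β N L' = (Lᴴ * L').trace := by
  rw [dotProduct, sum_tensor_eq, Finset.sum_comm]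
  rfl

theorem extendA_mulVec_vecTensor [DecidableEq β] (M : Matrix (Fin N → α) (Fin N → α) ℂ)
    (L : Matrix (Fin N → α) (Fin N → β) ℂ) :
    extendA M *ᵥ vecTensor α β N L = vecTensor α β N (M * L) := by
  ext x
  rw [Matrix.mulVec, dotProduct, sum_tensor_eq, vecTensor_apply, Matrix.mul_apply]
  refine Finset.sum_congr rfl fun a _ => ?_
  simp [extendA, vecTensor_apply, Matrix.one_apply]

theorem tensorPow_kronecker_mulVec_vecTensor [DecidableEq α] (U : Matrix β β ℂ)
    (L : Matrix (Fin N → α) (Fin N → β) ℂ) :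
    tensorPow N (Matrix.kronecker (1 : Matrix α α ℂ) U) *ᵥ vecTensor α β N L =
      vecTensor α β N (L * (tensorPow N U)ᵀ) := by
  ext x
  rw [Matrix.mulVec, dotProduct, sum_tensor_eq, vecTensor_apply, Matrix.mul_apply, Finset.sum_comm]
  refine Finset.sum_congr rfl fun b _ => ?_
  have : ∀ a : Fin N → α, ∏ i, (1 : Matrix α α ℂ) (x i).1 (a i) =
      if (fun i => (x i).1) = a then 1 else 0 := fun a => by
    simp [Matrix.one_apply, Finset.prod_ite_zero, funext_iff]
  simp [tensorPow, vecTensor_apply, Finset.prod_mul_distrib, this, mul_comm]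

theorem extendA_isTestOperator [DecidableEq α] [DecidableEq β]
    {M : Matrix (Fin N → α) (Fin N → α) ℂ} (hM : IsTestOperator M) :
    IsTestOperator (extendA M : Matrix (Fin N → α × β) (Fin N → α × β) ℂ) := by
  have hpsd : ∀ {M : Matrix (Fin N → α) (Fin N → α) ℂ}, M.PosSemidef →
      (extendA M : Matrix (Fin N → α × β) (Fin N → α × β) ℂ).PosSemidef := fun hM =>
    (hM.kronecker Matrix.PosSemidef.one).submatrix _
  refine ⟨hpsd hM.1, ?_⟩
  have : 1 - extendA M = (extendA (1 - M) : Matrix (Fin N → α × β) (Fin N → α × β) ℂ) := by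
    ext x y
    have hxy : x = y ↔ (fun i => (x i).1) = (fun i => (y i).1) ∧
        (fun i => (x i).2) = fun i => (y i).2 := by
      simp only [funext_iff, Prod.ext_iff, forall_and]
    simp only [extendA, Matrix.sub_apply, Matrix.submatrix_apply,
      Matrix.kronecker, Matrix.kroneckerMap_apply, Matrix.one_apply, hxy]
    split_ifs <;> simp_all
  rw [this]
  exact hpsd hM.2

variable [DecidableEq α]

theorem acceptProb_conj_eq (U : Matrix β β ℂ)
    (T : Matrix (Fin N → α × β) (Fin N → α × β) ℂ) (ρ : Matrix (α × β) (α × β) ℂ) :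
    acceptProb ((tensorPow N (Matrix.kronecker (1 : Matrix α α ℂ) U))ᴴ * T *
      tensorPow N (Matrix.kronecker (1 : Matrix α α ℂ) U)) ρ = acceptProb T (conjB U ρ) := by
  rw [acceptProb, acceptProb, conjB, tensorPow_mul, tensorPow_mul, tensorPow_conjTranspose]
  set K := tensorPow N (Matrix.kronecker (1 : Matrix α α ℂ) U)
  rw [Matrix.mul_assoc, Matrix.mul_assoc, Matrix.trace_mul_comm]
  simp only [Matrix.mul_assoc]

variable [DecidableEq β]

theorem conjTranspose_mul_self_tensorPow_kronecker {U : Matrix β β ℂ}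
    (hU : U ∈ Matrix.unitaryGroup β ℂ) :
    (tensorPow N (Matrix.kronecker (1 : Matrix α α ℂ) U))ᴴ *
      tensorPow N (Matrix.kronecker (1 : Matrix α α ℂ) U) = 1 := by
  have h : Uᴴ * U = 1 := Matrix.mem_unitaryGroup_iff'.1 hU
  rw [← tensorPow_conjTranspose, ← tensorPow_mul, Matrix.kronecker, Matrix.conjTranspose_kronecker,
    ← Matrix.mul_kronecker_mul, h, Matrix.conjTranspose_one, Matrix.one_mul,
    Matrix.one_kronecker_one, tensorPow_one]

/-! ### Invariant testers and local testers -/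

/-- The tester of least Frobenius norm among those with range in the symmetric subspace commutes
with all `(I ⊗ U)^{⊗N}`, because conjugation by these preserves the norm and the constraints. -/
theorem exists_isTester_commute {P : StateProperty (α × β)} (hpure : P.IsPure)
    (hinv : P.IsUnitarilyInvariantB) {c s : ℝ} {T : Matrix (Fin N → α × β) (Fin N → α × β) ℂ}
    (hT : IsTester P c s N T) :
    ∃ T', IsTester P c s N T' ∧ (∀ L, (vecTensor α β N).symm (T' *ᵥ L) ∈ symSpan α β N) ∧
      ∀ U ∈ Matrix.unitaryGroup β ℂ,
        Commute (tensorPow N (Matrix.kronecker (1 : Matrix α α ℂ) U)) T' := by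
  set S : Submodule ℂ ((Fin N → α × β) → ℂ) :=
    (symSpan α β N).comap (vecTensor α β N).symm.toLinearMap with hS
  let C : Set (Matrix (Fin N → α × β) (Fin N → α × β) ℂ) :=
    {T | IsTester P c s N T} ∩ {T | ∀ v, T *ᵥ v ∈ S}
  have hne : C.Nonempty := by
    obtain ⟨T', hT', hrange, hval⟩ := exists_isTestOperator_compression S hT.1
    refine ⟨T', hT.of_acceptProb_eq hT' fun ρ hρ => ?_, hrange⟩
    obtain ⟨ψ, -, rfl⟩ := hpure ρ hρ
    rw [acceptProb_vecMulVec, acceptProb_vecMulVec, hval]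
    exact tensorPowRect_mem_symSpan (Matrix.of fun a b => ψ (a, b))
  have hclosed : IsClosed C := by
    refine (isClosed_setOf_isTester P c s).inter ?_
    rw [Set.ofPred_forall]
    exact isClosed_iInter fun v => S.closed_of_finiteDimensional.preimage (by fun_prop)
  have hconv : Convex ℝ C := by
    refine (convex_setOf_isTester P c s).inter fun T hT T' hT' a b _ _ _ v => ?_
    rw [Matrix.add_mulVec, Matrix.smul_mulVec, Matrix.smul_mulVec]
    exact S.add_mem ((S.restrictScalars ℝ).smul_mem a (hT v))
      ((S.restrictScalars ℝ).smul_mem b (hT' v))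
  obtain ⟨T', hT', hmin⟩ := exists_unique_minimal_frobenius hne hclosed hconv
  refine ⟨T', hT'.1, hT'.2, fun U hU => ?_⟩
  set K := tensorPow N (Matrix.kronecker (1 : Matrix α α ℂ) U) with hK
  have hKK : Kᴴ * K = 1 := conjTranspose_mul_self_tensorPow_kronecker hU
  have hKK' : K * Kᴴ = 1 := mul_eq_one_comm.1 hKK
  have hfix : Kᴴ * T' * K = T' := by
    refine hmin _ ⟨⟨hT'.1.1.conjTranspose_mul_mul_same (by rw [hKK, sub_self]; exact .zero),
      fun ρ hρ => ?_, fun ρ hρ => ?_⟩, fun v => ?_⟩ (le_of_eq ?_)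
    · rw [acceptProb_conj_eq]; exact hT'.1.2 _ ((hinv U hU).1 ρ hρ)
    · rw [acceptProb_conj_eq]; exact hT'.1.3 _ ((hinv U hU).2 ρ hρ)
    · -- `(I ⊗ U)^{⊗N}` preserves the symmetric subspace
      obtain ⟨L, hL⟩ := (vecTensor α β N).surjective (T' *ᵥ (K *ᵥ v))
      have hLS : L ∈ symSpan α β N := by
        have := hT'.2 (K *ᵥ v)
        rwa [← hL, hS, Submodule.mem_comap, LinearEquiv.coe_coe,
          LinearEquiv.symm_apply_apply] at this
      have hKc : Kᴴ = tensorPow N (Matrix.kronecker (1 : Matrix α α ℂ) Uᴴ) := by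
        rw [hK, ← tensorPow_conjTranspose, Matrix.kronecker, Matrix.conjTranspose_kronecker,
          Matrix.conjTranspose_one]
      rw [Matrix.mul_assoc, ← Matrix.mulVec_mulVec, ← Matrix.mulVec_mulVec, ← hL, hKc,
        tensorPow_kronecker_mulVec_vecTensor, hS, Submodule.mem_comap, LinearEquiv.coe_coe,
        LinearEquiv.symm_apply_apply]
      exact mul_mem_symSpan hLS (tensorPowRect_mem_symSpan Uᴴᵀ)
    · have : (Kᴴ * T' * K)ᴴ * (Kᴴ * T' * K) = Kᴴ * (T'ᴴ * T' * K) := by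
        rw [Matrix.conjTranspose_mul, Matrix.conjTranspose_mul, Matrix.conjTranspose_conjTranspose]
        calc _ = Kᴴ * (T'ᴴ * ((K * Kᴴ) * (T' * K))) := by simp only [Matrix.mul_assoc]
          _ = _ := by rw [hKK', Matrix.one_mul, Matrix.mul_assoc]
      rw [this, Matrix.trace_mul_comm, Matrix.mul_assoc, hKK', Matrix.mul_one]
  calc K * T' = K * (Kᴴ * T' * K) := by rw [hfix]
    _ = (K * Kᴴ) * (T' * K) := by simp only [Matrix.mul_assoc]
    _ = T' * K := by rw [hKK', Matrix.one_mul]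

/-- The invariant tester acts on the symmetric subspace as a right-module map over the span of the
`Y^{⊗N}`, hence as left multiplication by a test operator on `H_A^{⊗N}`. -/
theorem exists_isTester_isLocalA {P : StateProperty (α × β)} (hpure : P.IsPure)
    (hinv : P.IsUnitarilyInvariantB) {c s : ℝ} {T : Matrix (Fin N → α × β) (Fin N → α × β) ℂ}
    (hT : IsTester P c s N T) : ∃ T', IsTester P c s N T' ∧ IsLocalA T' := by
  obtain ⟨T, hT, hrange, hcomm⟩ := exists_isTester_commute hpure hinv hT
  let Φ : Matrix (Fin N → α) (Fin N → β) ℂ →ₗ[ℂ] Matrix (Fin N → α) (Fin N → β) ℂ :=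
    (vecTensor α β N).symm.toLinearMap ∘ₗ T.mulVecLin ∘ₗ (vecTensor α β N).toLinearMap
  have hΦ : ∀ L, vecTensor α β N (Φ L) = T *ᵥ vecTensor α β N L := fun L =>
    (vecTensor α β N).apply_symm_apply _
  -- the right multiplications that commute with `Φ`; they include `U^{⊗N}` for unitary `U`, hence
  -- all of `symSpan β β N`
  let K : Subalgebra ℂ (Matrix (Fin N → β) (Fin N → β) ℂ) :=
    { carrier := {Y | ∀ L, Φ (L * Y) = Φ L * Y}
      mul_mem' := fun {Y Z} hY hZ L => by rw [← Matrix.mul_assoc, hZ, hY, Matrix.mul_assoc]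
      add_mem' := fun {Y Z} hY hZ L => by rw [Matrix.mul_add, Matrix.mul_add, map_add, hY, hZ]
      algebraMap_mem' := fun r L => by
        rw [Algebra.algebraMap_eq_smul_one, Matrix.mul_smul, Matrix.mul_smul, Matrix.mul_one,
          Matrix.mul_one, map_smul] }
  have hKU : ∀ U ∈ Matrix.unitaryGroup β ℂ, tensorPow N U ∈ K := by
    intro U hU L
    have hUt : Uᵀ ∈ Matrix.unitaryGroup β ℂ := Matrix.transpose_mem_unitaryGroup_iff.2 hU
    have h := tensorPow_kronecker_mulVec_vecTensor (α := α) (N := N) Uᵀ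
    have htr : (tensorPow N Uᵀ)ᵀ = tensorPow N U := rfl
    rw [htr] at h
    apply (vecTensor α β N).injective
    rw [hΦ, ← h, ← h, hΦ, Matrix.mulVec_mulVec, Matrix.mulVec_mulVec, (hcomm _ hUt).eq]
  have hKsym : ∀ Y ∈ symSpan β β N, Y ∈ K := by
    intro Y hY
    refine (Submodule.span_le (p := K.toSubmodule)).2 ?_ hY
    rintro _ ⟨X, rfl⟩
    exact tensorPow_mem_of_unitary K hKU X
  have hTH : Tᴴ = T := hT.1.1.isHermitian
  obtain ⟨M, hM, hML⟩ := exists_isTestOperator_mul_eq (symSpan α β N)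
    (fun L₁ h₁ L₂ h₂ L₃ h₃ =>
      mul_mem_symSpan h₁ (mul_mem_symSpan (conjTranspose_mem_symSpan h₂) h₃))
    Φ (fun L _ => hrange _)
    (fun L₁ _ L₂ h₂ L₃ h₃ => hKsym _ (mul_mem_symSpan (conjTranspose_mem_symSpan h₂) h₃) L₁)
    (fun L₁ _ L₂ _ => by
      rw [← star_vecTensor_dotProduct, ← star_vecTensor_dotProduct, hΦ, hΦ, Matrix.star_mulVec,
        hTH, Matrix.dotProduct_mulVec])
    (fun L _ => by
      rw [← star_vecTensor_dotProduct, hΦ]; exact hT.1.1.dotProduct_mulVec_nonneg _)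
    (fun L _ => by
      rw [← star_vecTensor_dotProduct, ← star_vecTensor_dotProduct, hΦ]
      have := hT.1.2.dotProduct_mulVec_nonneg (vecTensor α β N L)
      rwa [Matrix.sub_mulVec, Matrix.one_mulVec, dotProduct_sub, sub_nonneg] at this)
  refine ⟨extendA M, hT.of_acceptProb_eq (extendA_isTestOperator hM) fun ρ hρ => ?_, M, hM, rfl⟩
  obtain ⟨ψ, -, rfl⟩ := hpure ρ hρ
  rw [acceptProb_vecMulVec, acceptProb_vecMulVec, prod_eq_vecTensor, extendA_mulVec_vecTensor,
    hML _ (tensorPowRect_mem_symSpan _), hΦ]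

end Bipartite

theorem StateProperty.exists_isTester_eq_sampleComplexity {ι : Type*} [Fintype ι] [DecidableEq ι]
    (P : StateProperty ι) {c s : ℝ}
    (h : ∃ (N : ℕ) (T : Matrix (Fin N → ι) (Fin N → ι) ℂ), IsTester P c s N T) :
    ∃ N : ℕ, (N : ℕ∞) = P.sampleComplexity c s ∧
      ∃ T : Matrix (Fin N → ι) (Fin N → ι) ℂ, IsTester P c s N T := by
  classical
  refine ⟨Nat.find h, le_antisymm ?_ ?_, Nat.find_spec h⟩
  · exact le_iInf₂ fun N hN => Nat.cast_le.2 (Nat.find_min' h hN)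
  · exact iInf₂_le (Nat.find h) (Nat.find_spec h)

theorem theorem3p1 (dA dB : ℕ) (P : StateProperty (Fin dA × Fin dB))
    (hpure : P.IsPure) (hinv : P.IsUnitarilyInvariantB)
    (c s : ℝ) (hs : 0 ≤ s) (hsc : s < c) (hc : c ≤ 1) :
    -- every global tester can be replaced by a local one with the same number of samples
    (∀ (N : ℕ) (T : Matrix (Fin N → Fin dA × Fin dB) (Fin N → Fin dA × Fin dB) ℂ),
      IsTester P c s N T →
        ∃ T' : Matrix (Fin N → Fin dA × Fin dB) (Fin N → Fin dA × Fin dB) ℂ,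
          IsTester P c s N T' ∧ IsLocalA T') ∧
    -- the optimum over all global testers is attained by a local tester
    ((∃ (N : ℕ) (T : Matrix (Fin N → Fin dA × Fin dB) (Fin N → Fin dA × Fin dB) ℂ),
      IsTester P c s N T) →
        ∃ N : ℕ, (N : ℕ∞) = P.sampleComplexity c s ∧
          ∃ T' : Matrix (Fin N → Fin dA × Fin dB) (Fin N → Fin dA × Fin dB) ℂ,
            IsTester P c s N T' ∧ IsLocalA T') := by
  refine ⟨fun N T hT => exists_isTester_isLocalA hpure hinv hT, fun h => ?_⟩
  obtain ⟨N, hN, T, hT⟩ := P.exists_isTester_eq_sampleComplexity h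
  exact ⟨N, hN, exists_isTester_isLocalA hpure hinv hT⟩
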